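/- Let $X$ be an infinite-dimensional real Banach space and let $\Lambda\le X$ be a lattice, i.e. a topologically discrete subgroup whose real linear span is dense in $X$. Let $\mathbb{Q}\Lambda=\{\mathbf r\in X:\ q\mathbf r\in\Lambda\text{ for some integer }q\ge 1\}$, and for $\mathbf r\in\mathbb{Q}\Lambda$ let $H_{\mathrm{std}}(\mathbf r)=\min\{q\in\mathbb{N},\,q\ge 1:\ q\mathbf r\in\Lambda\}$. For $\psi:(0,\infty)\to(0,\infty)$ let $\mathrm{WA}_\psi$ be the set of well approximable points, i.e. the complement in $X$ of $$\mathrm{BA}_\psi=\{\mathbf x\in X:\ \exists\,\varepsilon>0\ \ \forall\,\mathbf r\in\mathbb{Q}\Lambda\quad \|\mathbf x-\mathbf r\|\ge\varepsilon\,\psi(H_{\mathrm{std}}(\mathbf r))\}.$$ For $s\ge 0$ let $\psi_s(q)=q^{-s}$. Write $\mathrm{HD}$ for Hausdorff dimension and, for $f:(0,\infty)\to(0,\infty)$, write $$\mathcal H^f(S)=\lim_{\delta\to 0}\ \inf\Big\{\sum_{n}f(\operatorname{diam}A_n):\ S\subseteq\bigcup_{n\in\mathbb N}A_n,\ \operatorname{diam}A_n\le\delta\Big\}$$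 for the Hausdorff $f$-measure, where empty sets contribute $0$ and one-point sets contribute a value $f(0)\in[0,\infty)$, which may be chosen arbitrarily. Then: (i) For every $s\ge 0$, $\mathrm{HD}(\mathrm{WA}_{\psi_s})=+\infty$. (ii) Suppose that $\Lambda$ is not strongly discrete, i.e. that $\Lambda\cap B(\mathbf 0,C)$ is infinite for some $C>0$. Then for every nonincreasing function $\psi:(0,\infty)\to(0,\infty)$ with $\psi(q)\to 0$ as $q\to\infty$, $\mathrm{HD}(\mathrm{WA}_\psi)=+\infty$. In fact, for every nondecreasing function $f:(0,\infty)\to(0,\infty)$, $\mathcal H^f(\mathrm{WA}_\psi)=+\infty$. -/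

import Mathlib

open Set Filter Topology MeasureTheory
open scoped NNReal ENNReal

noncomputable section

namespace BanachDiophantine

/-- The points of a metric space `X` that are badly approximable with respect to `ψ` by the
points `r ∈ Q`, where `r` has height `H r`. Only the values of `ψ` on `(0, ∞)` matter when `H`
is positive. -/
def badlyApproximable {X : Type*} [MetricSpace X] (Q : Set X) (H : Q → ℝ) (ψ : ℝ → ℝ) : Set X :=
  {x | ∃ ε : ℝ, 0 < ε ∧ ∀ r : Q, ε * ψ (H r) ≤ dist (r : X) x}

/-- The set of well approximable points: the complement of the badly approximable ones. -/
def wellApproximable {X : Type*} [MetricSpace X] (Q : Set X) (H : Q → ℝ) (ψ : ℝ → ℝ) : Set X :=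
  (badlyApproximable Q H ψ)ᶜ

/-- A lattice in a normed space: a topologically discrete subgroup which is contained in no proper
closed linear subspace (its real span is dense). -/
structure IsLattice {X : Type*} [NormedAddCommGroup X] [NormedSpace ℝ X]
    (Λ : AddSubgroup X) : Prop where
  discrete : DiscreteTopology Λ
  dense_span : Dense (Submodule.span ℝ (Λ : Set X) : Set X)

/-- A subgroup is strongly discrete if every ball contains only finitely many of its points. -/
def IsStronglyDiscrete {X : Type*} [NormedAddCommGroup X] (Λ : AddSubgroup X) : Prop :=
  ∀ C : ℝ, 0 < C → ((Λ : Set X) ∩ Metric.ball 0 C).Finite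

/-- The set `ℚΛ` of rational points: those `r` with `q • r ∈ Λ` for some integer `q ≥ 1`. -/
def rationalPoints {X : Type*} [NormedAddCommGroup X] (Λ : AddSubgroup X) : Set X :=
  {r | ∃ q : ℕ, 0 < q ∧ q • r ∈ Λ}

/-- The standard height of a rational point `r`: the least integer `q ≥ 1` with `q • r ∈ Λ`. -/
def stdHeight {X : Type*} [NormedAddCommGroup X] (Λ : AddSubgroup X)
    (r : rationalPoints Λ) : ℕ :=
  sInf {q : ℕ | 0 < q ∧ q • (r : X) ∈ Λ}

/-- `WA_ψ` for the space `X`, the rational points `ℚΛ` and the standard height. -/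
def WA {X : Type*} [NormedAddCommGroup X] (Λ : AddSubgroup X) (ψ : ℝ → ℝ) : Set X :=
  wellApproximable (rationalPoints Λ) (fun r => (stdHeight Λ r : ℝ)) ψ

/-- The Hausdorff `f`-measure
`H^f(S) = lim_{δ → 0} inf {∑ f (diam Aₙ) : S ⊆ ⋃ Aₙ, diam Aₙ ≤ δ}`, the infimum being over
countable covers. Empty sets contribute `0`, one-point sets contribute `f 0`; the value `⊤` at
infinite diameter plays no role in the limit. -/
def hausdorffGaugeMeasure {X : Type*} [MetricSpace X] (f : ℝ≥0 → ℝ≥0) : OuterMeasure X :=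
  OuterMeasure.mkMetric (fun d : ℝ≥0∞ => if d = ⊤ then ⊤ else (f d.toNNReal : ℝ≥0∞))

end BanachDiophantine

end

/-!
The set `WA Λ ψ` is bounded from below by a tree of balls. Fix denominators `q 0 ∣ q 1 ∣ ⋯` and
small radii `ρ n ≤ ψ (q n) / (n + 1)`. The vertices of level `n` are rational points `r` with
`q n • r ∈ Λ`, and the children of `r` are the points `r + v / q (n + 1)`, where `v` runs through
`N n` elements of `Λ` of norm at most `ρ n * q (n + 1) / 2`. Any point lying within `ρ n` of a
vertex of level `n` for all `n` is well approximable, and since `Λ` is discrete, with nonzero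
vectors of norm at least `lam`, siblings of level `n` are separated by a gap `g n` of the order of
`lam / q n`.

Instead of a measure on the limit set, the proof uses a greedy argument (`exists_branch_avoiding`).
Give each vertex of level `n` the mass `∏_{i < n} 1 / N i`, and assign to a set `A` of a cover the
last level `n` with `diam A < g n`, so that `A` meets at most one child of every vertex above that
level. If the masses of the assigned levels sum to less than `1`, there is a branch, built by
always passing to a child that carries less than its share of the cover, whose limit point lies in
no set of the cover. As a set of level `n + 1` has mass at most `1 / N n` and diameter at least
`g (n + 2)` (points are treated separately), the `f`-measure is infinite as soon as
`N n * f (g (n + 2)) ≥ n + 1` for all `n` (`hausdorffGaugeMeasure_eq_top_of_tree`,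
`hausdorffGaugeMeasure_WA_eq_top`).

* If some ball of radius `C` contains infinitely many points of `Λ`, it suffices to make
  `ρ n * q (n + 1) ≥ 2 * C`. Then the numbers `N n` are at one's disposal after all of the `q n`,
  and any gauge function `f` can be beaten. Finiteness of the dimension is excluded by
  `f t = t ^ D`.
* In general `Λ` contains `d` linearly independent vectors for every `d`, hence `K ^ d` points of
  norm `O(K)`. For `ψ q = q ^ (-s)` the choices `q (n + 1) = q n ^ a`, `ρ n = q n ^ (-σ)`,
  `N n = q n ^ d`, with `a` and `σ` depending only on `s`, satisfy the criterion for `f t = t ^ D`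
  once `d` is large in terms of `a` and `D`.
-/

namespace BanachDiophantine

/-! ### Branches of a tree of balls avoiding a light cover -/

/-- The mass `∏_{i < n} 1 / N i` carried by each vertex of level `n` of a tree in which every
vertex of level `i` has `N i` children, when the root has mass `1` and mass is shared equally. -/
noncomputable def treeMass (N : ℕ → ℕ) (n : ℕ) : ℝ≥0∞ :=
  ∏ i ∈ Finset.range n, (N i : ℝ≥0∞)⁻¹

theorem treeMass_zero (N : ℕ → ℕ) : treeMass N 0 = 1 := by
  simp [treeMass]

theorem natCast_mul_treeMass_succ {N : ℕ → ℕ} (hN : ∀ n, 0 < N n) (n : ℕ) :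
    (N n : ℝ≥0∞) * treeMass N (n + 1) = treeMass N n := by
  rw [treeMass, Finset.prod_range_succ, mul_comm, mul_assoc, ENNReal.inv_mul_cancel, mul_one]
  · rfl
  · exact_mod_cast (hN n).ne'
  · exact ENNReal.natCast_ne_top _

theorem treeMass_succ_le {N : ℕ → ℕ} (hN : ∀ n, 0 < N n) (n : ℕ) :
    treeMass N (n + 1) ≤ (N n : ℝ≥0∞)⁻¹ := by
  rw [treeMass, Finset.prod_range_succ]
  refine mul_le_of_le_one_left' (Finset.prod_le_one' fun i _ => ?_)
  exact ENNReal.inv_le_one.2 (by exact_mod_cast hN i)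

/-- A combinatorial mass distribution principle. Consider a tree of balls `closedBall t (ρ n)`,
`G n t`, in which a ball of level `n` contains `N n` balls of level `n + 1` lying at mutual distance
at least `g (n + 1)`. Let `A k` be sets to which levels `m k` are assigned such that `A k` is too
small to meet two sibling balls of level at most `m k`. If the total mass of the levels `m k` is
less than `1`, then some branch of the tree avoids each `A k` from the level `m k` on. -/
theorem exists_branch_avoiding {X : Type*} [MetricSpace X] {G : ℕ → X → Prop} {ρ : ℕ → ℝ}
    {g : ℕ → ℝ≥0∞} {N : ℕ → ℕ} (hN : ∀ n, 0 < N n) {r₀ : X} (h₀ : G 0 r₀)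
    (children : ∀ n r, G n r → ∃ T : Finset X, T.card = N n ∧
      (∀ t ∈ T, G (n + 1) t ∧ Metric.closedBall t (ρ (n + 1)) ⊆ Metric.closedBall r (ρ n)) ∧
      ∀ t ∈ T, ∀ t' ∈ T, t ≠ t' → ∀ x ∈ Metric.closedBall t (ρ (n + 1)),
        ∀ y ∈ Metric.closedBall t' (ρ (n + 1)), g (n + 1) ≤ edist x y)
    {A : ℕ → Set X} {m : ℕ → ℕ} (hA : ∀ k n, n < m k → Metric.ediam (A k) < g (n + 1))
    (hm : ∑' k, treeMass N (m k) < 1) :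
    ∃ r : ℕ → X, (∀ n, G n (r n)) ∧
      (∀ n, Metric.closedBall (r (n + 1)) (ρ (n + 1)) ⊆ Metric.closedBall (r n) (ρ n)) ∧
      ∀ k, Disjoint (A k) (Metric.closedBall (r (m k)) (ρ (m k))) := by
  classical
  -- `load n r` is the mass of those `A k`, of level at least `n`, that meet the ball about `r`.
  -- The branch is built greedily, keeping the load of a ball below its mass.
  let w : ℕ → X → ℕ → ℝ≥0∞ := fun n r k =>
    if n ≤ m k ∧ (A k ∩ Metric.closedBall r (ρ n)).Nonempty then treeMass N (m k) else 0
  let load : ℕ → X → ℝ≥0∞ := fun n r => ∑' k, w n r k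
  have step : ∀ n (r : {r : X // G n r ∧ load n r < treeMass N n}),
      ∃ t : {t : X // G (n + 1) t ∧ load (n + 1) t < treeMass N (n + 1)},
        Metric.closedBall t.1 (ρ (n + 1)) ⊆ Metric.closedBall r.1 (ρ n) := by
    rintro n ⟨r, hr, hload⟩
    obtain ⟨T, hcard, hT, hsep⟩ := children n r hr
    by_contra! hcon
    have hbig : ∀ t ∈ T, treeMass N (n + 1) ≤ load (n + 1) t := by
      intro t ht
      by_contra! hlt
      exact hcon ⟨t, (hT t ht).1, hlt⟩ (hT t ht).2
    have hterm : ∀ k, ∑ t ∈ T, w (n + 1) t k ≤ w n r k := by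
      intro k
      by_cases hex : ∃ t ∈ T, w (n + 1) t k ≠ 0
      · obtain ⟨t, ht, hwt⟩ := hex
        have hc : n + 1 ≤ m k ∧ (A k ∩ Metric.closedBall t (ρ (n + 1))).Nonempty := by
          by_contra hc
          exact hwt (if_neg hc)
        obtain ⟨hnm, x, hxA, hxt⟩ := hc
        have huniq : ∀ t' ∈ T, t' ≠ t → w (n + 1) t' k = 0 := by
          intro t' ht' hne
          refine if_neg ?_
          rintro ⟨-, y, hyA, hyt⟩
          exact absurd ((hsep t' ht' t ht hne y hyt x hxt).trans
            (Metric.edist_le_ediam_of_mem hyA hxA)) (not_le.2 (hA k n hnm))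
        rw [Finset.sum_eq_single_of_mem t ht huniq]
        have h1 : w (n + 1) t k ≤ treeMass N (m k) := by
          dsimp only [w]; split_ifs <;> simp
        refine h1.trans (le_of_eq (if_pos ⟨by omega, x, hxA, (hT t ht).2 hxt⟩).symm)
      · push Not at hex
        rw [Finset.sum_eq_zero hex]
        exact zero_le
    have : treeMass N n ≤ load n r := calc
      treeMass N n = ∑ t ∈ T, treeMass N (n + 1) := by
        rw [Finset.sum_const, hcard, nsmul_eq_mul, natCast_mul_treeMass_succ hN]
      _ ≤ ∑ t ∈ T, load (n + 1) t := Finset.sum_le_sum hbig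
      _ = ∑' k, ∑ t ∈ T, w (n + 1) t k :=
        (Summable.tsum_finsetSum fun _ _ => ENNReal.summable).symm
      _ ≤ load n r := ENNReal.tsum_le_tsum hterm
    exact absurd hload (not_lt.2 this)
  choose next hnext using step
  have hroot : load 0 r₀ < treeMass N 0 := by
    rw [treeMass_zero]
    refine lt_of_le_of_lt (ENNReal.tsum_le_tsum fun k => ?_) hm
    dsimp only [w]; split_ifs <;> simp
  let b : ∀ n, {r : X // G n r ∧ load n r < treeMass N n} :=
    fun n => Nat.rec ⟨r₀, h₀, hroot⟩ next n
  refine ⟨fun n => (b n).1, fun n => (b n).2.1, fun n => hnext n (b n), fun k => ?_⟩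
  rw [Set.disjoint_iff_inter_eq_empty]
  by_contra hne
  have hle : w (m k) (b (m k)).1 k ≤ load (m k) (b (m k)).1 := ENNReal.le_tsum k
  have hw : w (m k) (b (m k)).1 k = treeMass N (m k) :=
    if_pos ⟨le_rfl, Set.nonempty_iff_ne_empty.2 hne⟩
  rw [hw] at hle
  exact absurd (b (m k)).2.2 (not_lt.2 hle)

/-- A decreasing sequence of closed balls with radii tending to `0` in a complete space has a
common point. -/
theorem exists_mem_closedBall_of_nested {X : Type*} [MetricSpace X] [CompleteSpace X] {r : ℕ → X}
    {ρ : ℕ → ℝ} (hρ : ∀ n, 0 ≤ ρ n) (hρ₀ : Tendsto ρ atTop (𝓝 0))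
    (h : ∀ n, Metric.closedBall (r (n + 1)) (ρ (n + 1)) ⊆ Metric.closedBall (r n) (ρ n)) :
    ∃ x, ∀ n, x ∈ Metric.closedBall (r n) (ρ n) := by
  have hanti : Antitone fun n => Metric.closedBall (r n) (ρ n) := antitone_nat_of_succ_le h
  have := Metric.nonempty_iInter_of_nonempty_biInter
    (s := fun n => Metric.closedBall (r n) (ρ n)) (fun _ => Metric.isClosed_closedBall)
    (fun _ => Metric.isBounded_closedBall)
    (fun n => ⟨r n, mem_iInter₂.2 fun i hi => hanti hi (Metric.mem_closedBall_self (hρ n))⟩)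
    (squeeze_zero (fun _ => Metric.diam_nonneg)
      (fun n => Metric.diam_closedBall (hρ n)) (by simpa using hρ₀.const_mul 2))
  obtain ⟨x, hx⟩ := this
  exact ⟨x, fun n => mem_iInter.1 hx n⟩

/-! ### From trees to gauge measures -/

/-- To show that a gauge measure is infinite, it suffices to find, for every `M`, a scale `δ` at
which all covers cost at least a fixed multiple of `M`. -/
theorem hausdorffGaugeMeasure_eq_top {X : Type*} [MetricSpace X] {f : ℝ≥0 → ℝ≥0} {S : Set X}
    (h : ∀ M : ℕ, ∃ δ : ℝ≥0∞, 0 < δ ∧ δ ≠ ⊤ ∧ ∀ A : ℕ → Set X, S ⊆ ⋃ k, A k →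
      (∀ k, Metric.ediam (A k) ≤ δ) →
      (M : ℝ≥0∞) / 2 ≤ ∑' k, ⨆ _ : (A k).Nonempty, (f (Metric.ediam (A k)).toNNReal : ℝ≥0∞)) :
    hausdorffGaugeMeasure f S = ⊤ := by
  borelize X
  rw [hausdorffGaugeMeasure, OuterMeasure.coe_mkMetric, Measure.mkMetric_apply]
  refine ENNReal.eq_top_of_forall_nnreal_le fun c => ?_
  obtain ⟨M, hM⟩ := exists_nat_ge (2 * c)
  obtain ⟨δ, hδ, hδt, hcov⟩ := h M
  have hc : (c : ℝ≥0∞) ≤ (M : ℝ≥0∞) / 2 := by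
    rw [ENNReal.le_div_iff_mul_le (by simp) (by simp), mul_comm]
    exact_mod_cast hM
  refine hc.trans (le_iSup₂_of_le δ hδ (le_iInf fun A => le_iInf fun hS => le_iInf fun hd => ?_))
  refine (hcov A hS hd).trans (ENNReal.tsum_le_tsum fun k => iSup_mono fun _ => ?_)
  rw [if_neg ((hd k).trans_lt hδt.lt_top).ne]

theorem dimH_eq_top_of_hausdorffGaugeMeasure {X : Type*} [MetricSpace X] {S : Set X}
    (h : ∀ D : ℕ, 0 < D → hausdorffGaugeMeasure (fun t => t ^ D) S = ⊤) : dimH S = ⊤ := by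
  borelize X
  refine ENNReal.eq_top_of_forall_nnreal_le fun c => ?_
  obtain ⟨D, hD⟩ := exists_nat_ge c
  have hle : ((D + 1 : ℕ) : ℝ≥0) ≤ dimH S := by
    refine le_dimH_of_hausdorffMeasure_eq_top ?_
    rw [← h (D + 1) D.succ_pos, hausdorffGaugeMeasure, Measure.hausdorffMeasure,
      ← OuterMeasure.coe_mkMetric]
    congr 2
    funext d
    split_ifs with hd
    · subst hd
      exact ENNReal.top_rpow_of_pos (by positivity)
    · lift d to ℝ≥0 using hd
      rw [NNReal.coe_natCast, ENNReal.rpow_natCast, ENNReal.toNNReal_coe, ENNReal.coe_pow]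
  refine le_trans ?_ hle
  exact_mod_cast hD.trans (by push_cast; exact le_self_add)

/-- The level assigned to a set of diameter `d`. If the mass of a vertex of level `n + 1` is at most
`f (g (n + 2)) / (n + 1)`, there is a level `j` such that `d` lies below all gaps up to level `j`,
and such that the mass of level `j` is at most `f d / (M + 1)`. For `d = 0`, where `f` is arbitrary,
that mass can be made smaller than any given `η` instead. -/
theorem exists_level {N : ℕ → ℕ} {f : ℝ≥0 → ℝ≥0} (hf : MonotoneOn f (Ioi 0)) {g : ℕ → ℝ≥0}
    (hg : Antitone g) (hgpos : ∀ n, 0 < g n) (hg₀ : Tendsto g atTop (𝓝 0))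
    (hmass : ∀ n : ℕ, ((n + 1 : ℕ) : ℝ≥0∞) * treeMass N (n + 1) ≤ f (g (n + 2)))
    (M : ℕ) {d : ℝ≥0} (hd : d < g (M + 1)) {η : ℝ≥0∞} (hη : η ≠ 0) :
    ∃ j, (∀ n < j, d < g (n + 1)) ∧ (0 < d → ((M + 1 : ℕ) : ℝ≥0∞) * treeMass N j ≤ f d) ∧
      (d = 0 → treeMass N j ≤ η) := by
  rcases eq_zero_or_pos d with rfl | hdpos
  · -- Points can be put at arbitrarily deep levels, since the masses tend to `0`.
    obtain ⟨n, hn⟩ := ENNReal.exists_nat_mul_gt hη (ENNReal.coe_ne_top (r := f (g 2)))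
    refine ⟨n + 1, fun k _ => hgpos _, fun h => absurd h (lt_irrefl _), fun _ => ?_⟩
    by_contra! hlt
    have h1 : (f (g (n + 2)) : ℝ≥0∞) ≤ f (g 2) := by
      exact_mod_cast hf (hgpos _) (hgpos _) (hg (by omega))
    have h2 : (n : ℝ≥0∞) * η ≤ ((n + 1 : ℕ) : ℝ≥0∞) * treeMass N (n + 1) := by
      gcongr
      omega
    exact absurd hn (not_lt.2 (h2.trans ((hmass n).trans h1)))
  · have hex : ∃ n, g n ≤ d := (hg₀.eventually (ge_mem_nhds hdpos)).exists
    classical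
    -- The level is the last one whose gap exceeds `d`.
    have hmin : ∀ n < Nat.find hex, d < g n := fun n hn => not_le.1 (Nat.find_min hex hn)
    have hlarge : M + 1 < Nat.find hex := by
      by_contra! hle
      exact absurd hd (not_lt.2 ((hg hle).trans (Nat.find_spec hex)))
    obtain ⟨n, hn⟩ : ∃ n, Nat.find hex = n + 2 := ⟨Nat.find hex - 2, by omega⟩
    refine ⟨n + 1, fun k hk => hmin _ (by omega), fun _ => ?_, fun h => absurd h hdpos.ne'⟩
    calc ((M + 1 : ℕ) : ℝ≥0∞) * treeMass N (n + 1)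
        ≤ ((n + 1 : ℕ) : ℝ≥0∞) * treeMass N (n + 1) := by
          gcongr
          omega
      _ ≤ f (g (n + 2)) := hmass n
      _ ≤ f d := by
          have := Nat.find_spec hex
          rw [hn] at this
          exact_mod_cast hf (hgpos _) hdpos this

/-- The limit set of a tree of balls has infinite gauge measure when the number of children of the
vertices of level `n` beats `f` at the gap two levels further down: a cover of small total cost
would be avoided by some branch. -/
theorem hausdorffGaugeMeasure_eq_top_of_tree {X : Type*} [MetricSpace X] [CompleteSpace X]
    {G : ℕ → X → Prop} {ρ : ℕ → ℝ} {g : ℕ → ℝ≥0} {N : ℕ → ℕ} {f : ℝ≥0 → ℝ≥0} {S : Set X}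
    (hN : ∀ n, 0 < N n) (hρ : ∀ n, 0 ≤ ρ n) (hρ₀ : Tendsto ρ atTop (𝓝 0))
    (hf : MonotoneOn f (Ioi 0)) (hg : Antitone g) (hgpos : ∀ n, 0 < g n)
    (hg₀ : Tendsto g atTop (𝓝 0)) {r₀ : X} (h₀ : G 0 r₀)
    (children : ∀ n r, G n r → ∃ T : Finset X, T.card = N n ∧
      (∀ t ∈ T, G (n + 1) t ∧ Metric.closedBall t (ρ (n + 1)) ⊆ Metric.closedBall r (ρ n)) ∧
      ∀ t ∈ T, ∀ t' ∈ T, t ≠ t' → ∀ x ∈ Metric.closedBall t (ρ (n + 1)),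
        ∀ y ∈ Metric.closedBall t' (ρ (n + 1)), (g (n + 1) : ℝ≥0∞) ≤ edist x y)
    (hNf : ∀ n : ℕ, ((n + 1 : ℕ) : ℝ≥0) ≤ N n * f (g (n + 2)))
    (hS : ∀ r : ℕ → X, (∀ n, G n (r n)) → ∀ x, (∀ n, dist (r n) x ≤ ρ n) → x ∈ S) :
    hausdorffGaugeMeasure f S = ⊤ := by
  have hmass : ∀ n : ℕ, ((n + 1 : ℕ) : ℝ≥0∞) * treeMass N (n + 1) ≤ f (g (n + 2)) := fun n =>
    calc ((n + 1 : ℕ) : ℝ≥0∞) * treeMass N (n + 1)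
        ≤ (N n * f (g (n + 2)) : ℝ≥0∞) * (N n : ℝ≥0∞)⁻¹ :=
          mul_le_mul' (by exact_mod_cast hNf n) (treeMass_succ_le hN n)
      _ = f (g (n + 2)) := by
          rw [mul_right_comm, ENNReal.mul_inv_cancel (by exact_mod_cast (hN n).ne')
            (ENNReal.natCast_ne_top _), one_mul]
  refine hausdorffGaugeMeasure_eq_top fun M => ?_
  refine ⟨(g (M + 1) / 2 : ℝ≥0), by exact_mod_cast half_pos (hgpos _), ENNReal.coe_ne_top,
    fun A hSA hAd => ?_⟩
  by_contra! hlt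
  set F : ℕ → ℝ≥0∞ := fun k =>
    ⨆ _ : (A k).Nonempty, (f (Metric.ediam (A k)).toNNReal : ℝ≥0∞) with hF
  obtain ⟨η, hη, hηsum⟩ := ENNReal.exists_pos_sum_of_countable (ε := 2⁻¹) (by simp) ℕ
  have hlevel : ∀ k, ∃ j, (∀ n < j, Metric.ediam (A k) < g (n + 1)) ∧
      treeMass N j ≤ ((M + 1 : ℕ) : ℝ≥0∞)⁻¹ * F k + η k := by
    intro k
    have htop : Metric.ediam (A k) ≠ ⊤ := ((hAd k).trans_lt ENNReal.coe_lt_top).ne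
    have hsmall : (Metric.ediam (A k)).toNNReal < g (M + 1) := by
      have := hAd k
      rw [← ENNReal.coe_toNNReal htop, ENNReal.coe_le_coe] at this
      exact this.trans_lt (half_lt_self (hgpos _))
    obtain ⟨j, hj, hpos, hzero⟩ := exists_level hf hg hgpos hg₀ hmass M hsmall
      (η := η k) (by exact_mod_cast (hη k).ne')
    refine ⟨j, fun n hn => ?_, ?_⟩
    · rw [← ENNReal.coe_toNNReal htop]
      exact_mod_cast hj n hn
    · rcases eq_zero_or_pos (Metric.ediam (A k)).toNNReal with h | h
      · exact (hzero h).trans le_add_self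
      · have hne : (A k).Nonempty := by
          rw [Set.nonempty_iff_ne_empty]
          intro he
          simp [he] at h
        refine le_trans ?_ le_self_add
        rw [← ENNReal.mul_le_iff_le_inv (by simp) (by simp)]
        simpa only [hF, iSup_pos hne] using hpos h
  choose m hmd hmm using hlevel
  have hsum : ∑' k, treeMass N (m k) < 1 := calc
    ∑' k, treeMass N (m k) ≤ ∑' k, (((M + 1 : ℕ) : ℝ≥0∞)⁻¹ * F k + η k) := ENNReal.tsum_le_tsum hmm
    _ = ((M + 1 : ℕ) : ℝ≥0∞)⁻¹ * ∑' k, F k + ∑' k, (η k : ℝ≥0∞) := by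
      rw [ENNReal.tsum_add, ENNReal.tsum_mul_left]
    _ < 2⁻¹ + 2⁻¹ := by
      refine ENNReal.add_lt_add_of_le_of_lt ?_ ?_ hηsum
      · exact ENNReal.mul_ne_top (by simp) hlt.ne_top
      · rw [ENNReal.inv_mul_le_iff (by simp) (by simp)]
        refine hlt.le.trans ?_
        rw [ENNReal.div_eq_inv_mul, mul_comm]
        gcongr
        omega
    _ = 1 := ENNReal.inv_two_add_inv_two
  obtain ⟨r, hrG, hnest, hdisj⟩ := exists_branch_avoiding (g := fun n => (g n : ℝ≥0∞)) hN h₀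
    children (fun k n hn => hmd k n hn) hsum
  obtain ⟨x, hx⟩ := exists_mem_closedBall_of_nested hρ hρ₀ hnest
  obtain ⟨k, hk⟩ := mem_iUnion.1 (hSA (hS r hrG x fun n => by
    rw [dist_comm]; exact Metric.mem_closedBall.1 (hx n)))
  exact Set.disjoint_left.1 (hdisj k) hk (hx _)

/-! ### Lattice vectors and rational points -/

section

variable {X : Type*} [NormedAddCommGroup X]

theorem exists_pos_le_norm_of_discrete (Λ : AddSubgroup X) [DiscreteTopology Λ] :
    ∃ lam : ℝ, 0 < lam ∧ ∀ v ∈ Λ, v ≠ 0 → lam ≤ ‖v‖ := by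
  obtain ⟨lam, hpos, h⟩ := Metric.isOpen_singleton_iff.1 (isOpen_discrete ({0} : Set Λ))
  refine ⟨lam, hpos, fun v hv hne => ?_⟩
  by_contra! hlt
  exact hne (by simpa using h ⟨v, hv⟩ (by simpa [Subtype.dist_eq] using hlt))

theorem exists_finset_of_not_isStronglyDiscrete {Λ : AddSubgroup X}
    (h : ¬ IsStronglyDiscrete Λ) : ∃ C : ℝ, 0 < C ∧ ∀ n : ℕ, ∃ T : Finset X,
      (T : Set X) ⊆ Λ ∧ T.card = n ∧ ∀ v ∈ T, ‖v‖ ≤ C := by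
  simp only [IsStronglyDiscrete, not_forall] at h
  obtain ⟨C, hC, hinf⟩ := h
  refine ⟨C, hC, fun n => ?_⟩
  obtain ⟨T, hT, hcard⟩ := Set.Infinite.exists_subset_card_eq hinf n
  exact ⟨T, fun v hv => (hT hv).1, hcard, fun v hv => by
    simpa using (Metric.ball_subset_closedBall (hT hv).2)⟩

theorem stdHeight_le {Λ : AddSubgroup X} (r : rationalPoints Λ) {q : ℕ} (hq : 0 < q)
    (h : q • (r : X) ∈ Λ) : stdHeight Λ r ≤ q :=
  Nat.sInf_le ⟨hq, h⟩

theorem stdHeight_pos {Λ : AddSubgroup X} (r : rationalPoints Λ) : 0 < stdHeight Λ r :=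
  (Nat.sInf_mem (s := {q : ℕ | 0 < q ∧ q • (r : X) ∈ Λ}) r.2).1

/-- A point approximated by rational points `r n` with denominators `q n` to within
`ψ (q n) / (n + 1)` is well approximable. -/
theorem mem_WA_of_approx {Λ : AddSubgroup X} {ψ : ℝ → ℝ} (hψpos : ∀ t : ℝ, 0 < t → 0 < ψ t)
    (hψ : AntitoneOn ψ (Ioi 0)) {q : ℕ → ℕ} (hq : ∀ n, 0 < q n) {r : ℕ → X}
    (hr : ∀ n, q n • r n ∈ Λ) {x : X} (hx : ∀ n : ℕ, (n + 1) * dist (r n) x ≤ ψ (q n)) :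
    x ∈ WA Λ ψ := by
  rintro ⟨ε, hε, h⟩
  obtain ⟨n, hn⟩ := exists_nat_one_div_lt hε
  let r' : rationalPoints Λ := ⟨r n, q n, hq n, hr n⟩
  have hH : (0 : ℝ) < stdHeight Λ r' := by exact_mod_cast stdHeight_pos r'
  have h1 : ψ (q n) ≤ ψ (stdHeight Λ r') := hψ hH (mem_Ioi.2 (by exact_mod_cast hq n))
    (by exact_mod_cast stdHeight_le r' (hq n) (hr n))
  have h2 := h r'
  have hn0 : (0 : ℝ) < n + 1 := by positivity
  rw [div_lt_iff₀ hn0] at hn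
  have h3 : (n + 1) * (ε * ψ (stdHeight Λ r')) ≤ ψ (stdHeight Λ r') :=
    (mul_le_mul_of_nonneg_left h2 hn0.le).trans ((hx n).trans h1)
  nlinarith [hψpos _ hH]

variable [NormedSpace ℝ X]

/-! ### Trees of rational points -/

/-- The children of a rational point `r` of denominator `q`: from vectors of `Λ` of norm at most
`ρ q' / 2` one obtains as many rational points of denominator `q'` within `ρ / 2` of `r`. -/
theorem exists_children {Λ : AddSubgroup X} {lam : ℝ} (hsep : ∀ v ∈ Λ, v ≠ 0 → lam ≤ ‖v‖)
    {q q' : ℕ} (hq' : 0 < q') (hdvd : q ∣ q') {ρ ρ' : ℝ} (hρ : ρ' ≤ ρ / 2)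
    (hρ' : ρ' ≤ lam / (4 * q')) {T : Finset X} (hTΛ : (T : Set X) ⊆ Λ)
    (hT : ∀ v ∈ T, ‖v‖ ≤ ρ * q' / 2) {r : X} (hr : q • r ∈ Λ) :
    ∃ T' : Finset X, T'.card = T.card ∧
      (∀ t ∈ T', q' • t ∈ Λ ∧ Metric.closedBall t ρ' ⊆ Metric.closedBall r ρ) ∧
      ∀ t ∈ T', ∀ t' ∈ T', t ≠ t' → ∀ x ∈ Metric.closedBall t ρ',
        ∀ y ∈ Metric.closedBall t' ρ', lam / (2 * q') ≤ dist x y := by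
  classical
  have hq0 : (0 : ℝ) < q' := by exact_mod_cast hq'
  have hinj : Function.Injective fun v : X => r + (q' : ℝ)⁻¹ • v := fun v w hvw =>
    smul_right_injective X (inv_ne_zero hq0.ne') (add_left_cancel hvw)
  refine ⟨T.image fun v => r + (q' : ℝ)⁻¹ • v, Finset.card_image_of_injective _ hinj, ?_, ?_⟩
  · intro t ht
    obtain ⟨v, hv, rfl⟩ := Finset.mem_image.1 ht
    refine ⟨?_, ?_⟩
    · obtain ⟨k, rfl⟩ := hdvd
      rw [smul_add, ← Nat.cast_smul_eq_nsmul ℝ (q * k) ((_ : ℝ) • v), smul_inv_smul₀ hq0.ne',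
        mul_comm, mul_smul]
      exact Λ.add_mem (Λ.nsmul_mem hr k) (hTΛ hv)
    · refine Metric.closedBall_subset_closedBall' ?_
      have : dist (r + (q' : ℝ)⁻¹ • v) r ≤ ρ / 2 := by
        rw [dist_eq_norm, add_sub_cancel_left, norm_smul, norm_inv, Real.norm_of_nonneg hq0.le,
          inv_mul_le_iff₀ hq0]
        linarith [hT v hv]
      linarith
  · intro t ht t' ht' hne x hx y hy
    obtain ⟨v, hv, rfl⟩ := Finset.mem_image.1 ht
    obtain ⟨w, hw, rfl⟩ := Finset.mem_image.1 ht'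
    have hvw : v - w ≠ 0 := sub_ne_zero.2 fun h => hne (by rw [h])
    have h1 : lam / q' ≤ dist (r + (q' : ℝ)⁻¹ • v) (r + (q' : ℝ)⁻¹ • w) := by
      rw [dist_add_left, dist_smul₀, dist_eq_norm, norm_inv, Real.norm_of_nonneg hq0.le,
        div_eq_inv_mul]
      gcongr
      exact hsep _ (Λ.sub_mem (hTΛ hv) (hTΛ hw)) hvw
    have h2 := dist_triangle4 (r + (q' : ℝ)⁻¹ • v) x y (r + (q' : ℝ)⁻¹ • w)
    rw [Metric.mem_closedBall] at hx hy
    rw [dist_comm] at hx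
    have h3 : lam / (4 * q') = lam / q' / 4 := by field_simp
    have h4 : lam / (2 * q') = lam / q' / 2 := by field_simp
    linarith

/-- The criterion behind both parts of the theorem: `WA Λ ψ` has infinite `f`-measure as soon as
denominators `q n`, radii `ρ n` and numbers of children `N n` can be chosen so that `Λ` has `N n`
points in the ball of radius `ρ n * q (n + 1) / 2` and `N n` is large in terms of `q (n + 2)`. -/
theorem hausdorffGaugeMeasure_WA_eq_top [CompleteSpace X] {Λ : AddSubgroup X} {lam : ℝ}
    (hlam : 0 < lam) (hsep : ∀ v ∈ Λ, v ≠ 0 → lam ≤ ‖v‖) {ψ : ℝ → ℝ}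
    (hψpos : ∀ t : ℝ, 0 < t → 0 < ψ t) (hψ : AntitoneOn ψ (Ioi 0)) {f : ℝ≥0 → ℝ≥0}
    (hf : MonotoneOn f (Ioi 0)) {q : ℕ → ℕ} (hq₀ : 0 < q 0) (hq : StrictMono q)
    (hdvd : ∀ n, q n ∣ q (n + 1)) {ρ : ℕ → ℝ} (hρpos : ∀ n, 0 < ρ n)
    (hρ : ∀ n, ρ (n + 1) ≤ ρ n / 2) (hρq : ∀ n, ρ n ≤ lam / (4 * q n))
    (hρψ : ∀ n : ℕ, (n + 1) * ρ n ≤ ψ (q n)) {N : ℕ → ℕ} (hN : ∀ n, 0 < N n)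
    (hT : ∀ n, ∃ T : Finset X, (T : Set X) ⊆ Λ ∧ T.card = N n ∧ ∀ v ∈ T, ‖v‖ ≤ ρ n * q (n + 1) / 2)
    (hNf : ∀ n : ℕ, ((n + 1 : ℕ) : ℝ≥0) ≤ N n * f (lam / (2 * q (n + 2))).toNNReal) :
    hausdorffGaugeMeasure f (WA Λ ψ) = ⊤ := by
  have hqpos : ∀ n, 0 < q n := fun n => hq₀.trans_le (hq.monotone n.zero_le)
  have hqR : ∀ n, (0 : ℝ) < q n := fun n => by exact_mod_cast hqpos n
  have hqtop : Tendsto (fun n => (q n : ℝ)) atTop atTop :=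
    tendsto_natCast_atTop_atTop.comp hq.tendsto_atTop
  have hgap : ∀ c : ℝ, 0 < c → Tendsto (fun n => lam / (c * q n)) atTop (𝓝 0) := fun c hc =>
    tendsto_const_nhds.div_atTop (hqtop.const_mul_atTop hc)
  refine hausdorffGaugeMeasure_eq_top_of_tree (G := fun n r => q n • r ∈ Λ) (ρ := ρ)
    (g := fun n => (lam / (2 * q n)).toNNReal) (r₀ := 0) hN (fun n => (hρpos n).le)
    (squeeze_zero (fun n => (hρpos n).le) hρq (hgap 4 (by norm_num))) hf ?_ ?_ ?_ (by simp) ?_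
    hNf ?_
  · intro m n hmn
    refine Real.toNNReal_le_toNNReal ?_
    have := hqR m
    have : q m ≤ q n := hq.monotone hmn
    gcongr
  · intro n
    have := hqR n
    exact Real.toNNReal_pos.2 (by positivity)
  · simpa using tendsto_real_toNNReal (hgap 2 (by norm_num))
  · intro n r hr
    obtain ⟨T, hTΛ, hcard, hTn⟩ := hT n
    obtain ⟨T', h1, h2, h3⟩ := exists_children hsep (hqpos (n + 1)) (hdvd n) (hρ n)
      (hρq (n + 1)) hTΛ hTn hr
    refine ⟨T', h1.trans hcard, h2, fun t ht t' ht' hne x hx y hy => ?_⟩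
    rw [edist_dist]
    exact ENNReal.ofReal_le_ofReal (h3 t ht t' ht' hne x hx y hy)
  · intro r hr x hx
    refine mem_WA_of_approx hψpos hψ hqpos hr fun n => le_trans ?_ (hρψ n)
    gcongr
    exact hx n

/-! ### Lattices that are not strongly discrete -/

theorem hausdorffGaugeMeasure_WA_of_not_isStronglyDiscrete [CompleteSpace X] {Λ : AddSubgroup X}
    [DiscreteTopology Λ] (hΛ : ¬ IsStronglyDiscrete Λ) {ψ : ℝ → ℝ}
    (hψpos : ∀ t : ℝ, 0 < t → 0 < ψ t) (hψ : AntitoneOn ψ (Ioi 0)) {f : ℝ≥0 → ℝ≥0}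
    (hfpos : ∀ t : ℝ≥0, 0 < t → 0 < f t) (hf : MonotoneOn f (Ioi 0)) :
    hausdorffGaugeMeasure f (WA Λ ψ) = ⊤ := by
  obtain ⟨lam, hlam, hsep⟩ := exists_pos_le_norm_of_discrete Λ
  obtain ⟨C, hC, hT⟩ := exists_finset_of_not_isStronglyDiscrete hΛ
  -- The radius `R n (q n)` depends on `q n`, and `q (n + 1)` is a multiple of `q n` so large that
  -- the ball of radius `R n (q n) * q (n + 1) / 2` contains infinitely many lattice points.
  let R : ℕ → ℕ → ℝ := fun n q => min (ψ q) (lam / (4 * q)) / 2 ^ n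
  obtain ⟨q, hq0, hqs⟩ : ∃ q : ℕ → ℕ, q 0 = 1 ∧
      ∀ n, q (n + 1) = q n * (⌈2 * C / R n (q n)⌉₊ + 2) :=
    ⟨fun n => Nat.rec 1 (fun n q => q * (⌈2 * C / R n q⌉₊ + 2)) n, rfl, fun _ => rfl⟩
  have hqpos : ∀ n, 0 < q n := by
    intro n
    induction n with
    | zero => exact hq0 ▸ Nat.one_pos
    | succ n ih => rw [hqs]; positivity
  have hqR : ∀ n, (0 : ℝ) < q n := fun n => by exact_mod_cast hqpos n
  have hq : StrictMono q := strictMono_nat_of_lt_succ fun n => by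
    rw [hqs]
    nlinarith [hqpos n, Nat.zero_le ⌈2 * C / R n (q n)⌉₊]
  have hmin : ∀ n, (0 : ℝ) < min (ψ (q n)) (lam / (4 * q n)) := fun n =>
    lt_min (hψpos _ (hqR n)) (by have := hqR n; positivity)
  have hRpos : ∀ n, 0 < R n (q n) := fun n => div_pos (hmin n) (by positivity)
  -- Since the gaps do not involve the numbers of children, these can be chosen last.
  have hgpos : ∀ n, 0 < f (lam / (2 * q n)).toNNReal := fun n => by
    have := hqR n
    exact hfpos _ (Real.toNNReal_pos.2 (by positivity))
  refine hausdorffGaugeMeasure_WA_eq_top (ρ := fun n => R n (q n))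
    (N := fun n => ⌈((n + 1 : ℕ) : ℝ≥0) / f (lam / (2 * q (n + 2))).toNNReal⌉₊ + 1)
    hlam hsep hψpos hψ hf (hqpos 0) hq (fun n => ⟨_, hqs n⟩) hRpos ?_ ?_ ?_
    (fun n => Nat.succ_pos _) ?_ ?_
  · intro n
    have hle : (q n : ℝ) ≤ q (n + 1) := by exact_mod_cast hq.monotone n.le_succ
    have h1 : min (ψ (q (n + 1))) (lam / (4 * q (n + 1))) ≤ min (ψ (q n)) (lam / (4 * q n)) := by
      refine min_le_min (hψ (hqR n) (hqR _) hle) ?_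
      have := hqR n
      gcongr
    simp only [R]
    rw [pow_succ, ← div_div]
    gcongr
  · intro n
    exact (div_le_self (hmin n).le (one_le_pow₀ one_le_two)).trans (min_le_right _ _)
  · intro n
    have h1 : ((n + 1 : ℕ) : ℝ) ≤ 2 ^ n := by exact_mod_cast Nat.lt_two_pow_self
    have h2 : ((n : ℝ) + 1) * R n (q n) ≤ 2 ^ n * R n (q n) := by
      have := hRpos n
      push_cast at h1
      gcongr
    refine h2.trans ?_
    rw [mul_div_cancel₀ _ (by positivity)]
    exact min_le_left _ _
  · intro n
    obtain ⟨T, h1, h2, h3⟩ := hT (⌈((n + 1 : ℕ) : ℝ≥0) / f (lam / (2 * q (n + 2))).toNNReal⌉₊ + 1)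
    refine ⟨T, h1, h2, fun v hv => (h3 v hv).trans ?_⟩
    have h4 : 2 * C / R n (q n) ≤ q (n + 1) := by
      have h5 : (1 : ℝ) ≤ q n := by exact_mod_cast hqpos n
      rw [hqs]
      push_cast
      nlinarith [Nat.le_ceil (2 * C / R n (q n)), Nat.cast_nonneg (α := ℝ) ⌈2 * C / R n (q n)⌉₊]
    rw [div_le_iff₀ (hRpos n)] at h4
    linarith
  · intro n
    rw [← div_le_iff₀ (hgpos _)]
    push_cast
    exact (by exact_mod_cast Nat.le_ceil _ : _ ≤ _).trans le_self_add

/-! ### Power approximation functions -/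

/-- The span of a lattice in an infinite-dimensional space has infinite dimension, as otherwise it
would be closed. -/
theorem exists_linearIndependent_of_isLattice (hX : ¬ FiniteDimensional ℝ X) {Λ : AddSubgroup X}
    (hΛ : IsLattice Λ) (d : ℕ) : ∃ b : Fin d → X, LinearIndependent ℝ b ∧ ∀ i, b i ∈ Λ := by
  obtain ⟨s, hs, hspan, hli⟩ := exists_linearIndependent ℝ (Λ : Set X)
  have hinf : s.Infinite := by
    intro hfin
    apply hX
    have hfd : FiniteDimensional ℝ (Submodule.span ℝ s) := FiniteDimensional.span_of_finite ℝ hfin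
    have htop : Submodule.span ℝ s = ⊤ := by
      rw [← (Submodule.span ℝ s).closed_of_finiteDimensional.submodule_topologicalClosure_eq, hspan]
      exact (Submodule.dense_iff_topologicalClosure_eq_top).1 hΛ.dense_span
    rw [htop] at hfd
    exact Module.finite_def.2 (Module.Finite.iff_fg.1 hfd)
  have := hinf.to_subtype
  let e : Fin d ↪ s := Fin.valEmbedding.trans (Infinite.natEmbedding s)
  exact ⟨fun i => e i, hli.comp e e.injective, fun i => hs (e i).2⟩

/-- A lattice in an infinite-dimensional space has, for each `d`, at least of the order of `K ^ d`
points in the ball of radius `K`. -/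
theorem exists_finset_of_isLattice (hX : ¬ FiniteDimensional ℝ X) {Λ : AddSubgroup X}
    (hΛ : IsLattice Λ) (d : ℕ) : ∃ B : ℝ, 0 ≤ B ∧ ∀ K : ℕ, ∃ T : Finset X,
      (T : Set X) ⊆ Λ ∧ T.card = K ^ d ∧ ∀ v ∈ T, ‖v‖ ≤ K * B := by
  classical
  obtain ⟨b, hb, hbΛ⟩ := exists_linearIndependent_of_isLattice hX hΛ d
  refine ⟨∑ i, ‖b i‖, Finset.sum_nonneg fun i _ => norm_nonneg _, fun K => ?_⟩
  let F : (Fin d → Fin K) → X := fun a => ∑ i, ((a i : ℕ) : ℝ) • b i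
  have hF : Function.Injective F := by
    intro a a' h
    have h0 : ∑ i, (((a i : ℕ) : ℝ) - ((a' i : ℕ) : ℝ)) • b i = 0 := by
      simp only [sub_smul, Finset.sum_sub_distrib]
      exact sub_eq_zero.2 h
    funext i
    have := Fintype.linearIndependent_iff.1 hb _ h0 i
    exact Fin.ext (by exact_mod_cast sub_eq_zero.1 this)
  refine ⟨Finset.univ.image F, ?_, ?_, ?_⟩
  · intro v hv
    obtain ⟨a, -, rfl⟩ := Finset.mem_image.1 (Finset.mem_coe.1 hv)
    refine Λ.sum_mem fun i _ => ?_
    rw [Nat.cast_smul_eq_nsmul]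
    exact Λ.nsmul_mem (hbΛ i) _
  · rw [Finset.card_image_of_injective _ hF]
    simp
  · intro v hv
    obtain ⟨a, -, rfl⟩ := Finset.mem_image.1 hv
    rw [Finset.mul_sum]
    refine (norm_sum_le _ _).trans (Finset.sum_le_sum fun i _ => ?_)
    rw [norm_smul, Real.norm_of_nonneg (Nat.cast_nonneg _)]
    gcongr
    exact (a i).2.le

theorem hausdorffGaugeMeasure_WA_rpow [CompleteSpace X] (hX : ¬ FiniteDimensional ℝ X)
    {Λ : AddSubgroup X} (hΛ : IsLattice Λ) {s : ℝ} (hs : 0 ≤ s) (D : ℕ) :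
    hausdorffGaugeMeasure (fun t => t ^ D) (WA Λ fun q : ℝ => q ^ (-s)) = ⊤ := by
  have := hΛ.discrete
  obtain ⟨lam, hlam, hsep⟩ := exists_pos_le_norm_of_discrete Λ
  -- With denominators `q (n + 1) = q n ^ a` and radii `q n ^ (-σ)`, where `a = σ + 2`, a ball of
  -- level `n` has room for `q n ^ d` children, while the gap two levels further down is of the
  -- order of `q n ^ (-a ^ 2)`; hence the choice of `d` in terms of `D`.
  obtain ⟨σ, hσ⟩ := exists_nat_ge (s + 2)
  set a : ℕ := σ + 2 with ha
  set d : ℕ := (a * a + 1) * D + 1 with hd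
  obtain ⟨B, hB, hT⟩ := exists_finset_of_isLattice hX hΛ d
  obtain ⟨Q, hQ⟩ := exists_nat_ge (max 2 (max (4 / lam) (2 * B)))
  obtain ⟨hQ2, hQ⟩ := max_le_iff.1 hQ
  obtain ⟨hQlam, hQB⟩ := max_le_iff.1 hQ
  have hQ2' : 2 ≤ Q := by exact_mod_cast hQ2
  have hσ2 : 2 ≤ σ := by
    have : (2 : ℝ) ≤ σ := by linarith
    exact_mod_cast this
  let q : ℕ → ℕ := fun n => Q ^ a ^ n
  have hqs : ∀ n, q (n + 1) = q n ^ a := fun n => by simp only [q]; rw [pow_succ, pow_mul]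
  have hq : StrictMono q := (pow_right_strictMono₀ hQ2').comp
    (pow_right_strictMono₀ (by omega))
  have hQq : ∀ n, Q ≤ q n := fun n =>
    (pow_one Q).symm.le.trans (Nat.pow_le_pow_right (by omega) (Nat.one_le_pow _ _ (by omega)))
  have hQq' : ∀ n, (Q : ℝ) ≤ q n := fun n => by exact_mod_cast hQq n
  have hnq : ∀ n, n + 1 ≤ q n := fun n => by
    induction n with
    | zero => linarith [hQq 0]
    | succ n ih => exact Nat.succ_le_of_lt (ih.trans_lt (hq n.lt_succ_self))
  have hnq' : ∀ n : ℕ, (n : ℝ) + 1 ≤ q n := fun n => by exact_mod_cast hnq n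
  have hq1 : ∀ n, (1 : ℝ) ≤ q n := fun n => by linarith [hQq' n]
  have hqR : ∀ n, (0 : ℝ) < q n := fun n => by linarith [hq1 n]
  have hq4 : ∀ n, 4 ≤ lam * q n := fun n => by
    rw [div_le_iff₀ hlam] at hQlam
    nlinarith [hQq' n]
  refine hausdorffGaugeMeasure_WA_eq_top (q := q) (ρ := fun n => ((q n : ℝ) ^ σ)⁻¹)
    (N := fun n => q n ^ d) hlam hsep (fun t ht => Real.rpow_pos_of_pos ht _)
    (fun x hx y _ hxy => Real.rpow_le_rpow_of_nonpos hx hxy (by linarith))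
    (fun x _ y _ hxy => pow_le_pow_left' hxy D) (by have := hnq 0; omega) hq
    (fun n => hqs n ▸ dvd_pow_self _ (by omega)) (fun n => by have := hqR n; positivity)
    ?_ ?_ ?_ (fun n => by have := hnq n; positivity) ?_ ?_
  · intro n
    have h0 := hqR n
    have h1 : (2 : ℝ) * q n ≤ q (n + 1) := by
      rw [hqs]
      push_cast
      calc (2 : ℝ) * q n ≤ q n ^ 2 := by nlinarith [hQq' n]
        _ ≤ q n ^ a := pow_le_pow_right₀ (hq1 n) (by omega)
    have h2 : (2 : ℝ) * q n ^ σ ≤ q (n + 1) ^ σ := calc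
      (2 : ℝ) * q n ^ σ ≤ 2 ^ σ * q n ^ σ := by
        gcongr
        exact le_self_pow₀ one_le_two (by omega)
      _ = (2 * q n) ^ σ := (mul_pow _ _ _).symm
      _ ≤ q (n + 1) ^ σ := by gcongr
    rw [div_eq_inv_mul, ← mul_inv]
    exact inv_anti₀ (by positivity) h2
  · intro n
    have h0 := hqR n
    rw [inv_le_comm₀ (by positivity) (by positivity), inv_div, div_le_iff₀ hlam]
    calc 4 * (q n : ℝ) ≤ lam * q n * q n := by gcongr; exact hq4 n
      _ = q n ^ 2 * lam := by ring
      _ ≤ q n ^ σ * lam := by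
        gcongr
        exact hq1 n
  · intro n
    have h0 := hqR n
    rw [← Real.rpow_natCast, ← Real.rpow_neg h0.le]
    calc ((n : ℝ) + 1) * (q n : ℝ) ^ (-(σ : ℝ)) ≤ q n * (q n : ℝ) ^ (-(σ : ℝ)) := by
          gcongr
          exact hnq' n
      _ = (q n : ℝ) ^ (1 - (σ : ℝ)) := by
          rw [sub_eq_add_neg, Real.rpow_add h0, Real.rpow_one]
      _ ≤ (q n : ℝ) ^ (-s) := Real.rpow_le_rpow_of_exponent_le (hq1 n) (by linarith)
  · intro n
    have h0 := hqR n
    obtain ⟨T, h1, h2, h3⟩ := hT (q n)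
    refine ⟨T, h1, h2, fun v hv => (h3 v hv).trans ?_⟩
    rw [hqs]
    push_cast
    rw [ha, pow_add, inv_mul_cancel_left₀ (by positivity)]
    nlinarith [hQq' n]
  · intro n
    have h0 := hqR n
    have hgap : ((q n : ℝ) ^ (a * a + 1))⁻¹ ≤ lam / (2 * q (n + 2)) := by
      rw [hqs, hqs, ← pow_mul, pow_succ]
      push_cast
      rw [inv_le_comm₀ (by positivity) (by positivity), inv_div, div_le_iff₀ hlam]
      have h4 := hq4 n
      have h5 : (0 : ℝ) < q n ^ (a * a) := by positivity
      nlinarith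
    have hgap' : ((q n : ℝ≥0) ^ (a * a + 1))⁻¹ ≤ (lam / (2 * q (n + 2))).toNNReal := by
      rw [Real.le_toNNReal_iff_coe_le' (by positivity)]
      exact_mod_cast hgap
    have hqN : (0 : ℝ≥0) < q n := by exact_mod_cast h0
    calc ((n + 1 : ℕ) : ℝ≥0) ≤ q n := by exact_mod_cast hnq n
      _ = (q n : ℝ≥0) ^ d * (((q n : ℝ≥0) ^ (a * a + 1))⁻¹) ^ D := by
        rw [hd, pow_succ, inv_pow, ← pow_mul, mul_comm (_ ^ _) (q n : ℝ≥0), mul_assoc,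
          mul_inv_cancel₀ (by positivity), mul_one]
      _ ≤ ((q n ^ d : ℕ) : ℝ≥0) * (lam / (2 * q (n + 2))).toNNReal ^ D := by
        push_cast
        gcongr

end

end BanachDiophantine

theorem mainTheorem5 {X : Type*} [NormedAddCommGroup X] [NormedSpace ℝ X] [CompleteSpace X]
    (hX : ¬ FiniteDimensional ℝ X) (Λ : AddSubgroup X) (hΛ : BanachDiophantine.IsLattice Λ) :
    (∀ s : ℝ, 0 ≤ s → dimH (BanachDiophantine.WA Λ (fun q : ℝ => q ^ (-s))) = ⊤) ∧
    (¬ BanachDiophantine.IsStronglyDiscrete Λ →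
      ∀ ψ : ℝ → ℝ, (∀ q : ℝ, 0 < q → 0 < ψ q) → AntitoneOn ψ (Set.Ioi 0) →
        Tendsto ψ atTop (𝓝 0) →
        dimH (BanachDiophantine.WA Λ ψ) = ⊤ ∧
        ∀ f : ℝ≥0 → ℝ≥0, (∀ t : ℝ≥0, 0 < t → 0 < f t) → MonotoneOn f (Set.Ioi 0) →
          BanachDiophantine.hausdorffGaugeMeasure f (BanachDiophantine.WA Λ ψ) = ⊤) := by
  have := hΛ.discrete
  refine ⟨fun s hs => ?_, fun hsd ψ hψpos hψ _ => ?_⟩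
  · exact BanachDiophantine.dimH_eq_top_of_hausdorffGaugeMeasure fun D _ =>
      BanachDiophantine.hausdorffGaugeMeasure_WA_rpow hX hΛ hs D
  · have key : ∀ f : ℝ≥0 → ℝ≥0, (∀ t : ℝ≥0, 0 < t → 0 < f t) → MonotoneOn f (Set.Ioi 0) →
        BanachDiophantine.hausdorffGaugeMeasure f (BanachDiophantine.WA Λ ψ) = ⊤ := fun f hfpos hf =>
      BanachDiophantine.hausdorffGaugeMeasure_WA_of_not_isStronglyDiscrete hsd hψpos hψ hfpos hf
    exact ⟨BanachDiophantine.dimH_eq_top_of_hausdorffGaugeMeasure fun D _ =>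
      key _ (fun t ht => pow_pos ht D) (fun x _ y _ hxy => pow_le_pow_left' hxy D), key⟩
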